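/- All linear orders below are countable. Embeddings are order embeddings; for embeddings $f,g:X\to Y$ we write $f\le g$ if $f(x)\le g(x)$ for all $x\in X$. Write $[X]^{<\omega}$ for the set of finite subsets of $X$, put $[f]^{<\omega}(a)=\{f(x)\mid x\in a\}$, and identify $n\in\mathbb N$ with the linear order $\{0<\dots<n-1\}$. A *predilator* $D$ consists of a functor from the category of the orders $n\in\mathbb N$ and embeddings to the category of linear orders and embeddings, which is monotone (i.e. $f\le g$ implies $D(f)\le D(g)$), and of a natural family of functions $\operatorname{supp}_n:D(n)\to[n]^{<\omega}$ such that, for each embedding $f:m\to n$, any $\tau\in D(n)$ with $\operatorname{supp}_n(\tau)\subseteq\operatorname{rng}(f)$ lies in $\operatorname{rng}(D(f))$. For a linear order $\alpha$ let $$\overline D(\alpha)=\{(\sigma,a)\mid a\in[\alpha]^{<\omega},\ \sigma\in D(|a|),\ \operatorname{supp}_{|a|}(\sigma)=\{0,\dots,|a|-1\}\},$$ ordered by $(\sigma,a)\le(\tau,b)\Leftrightarrow D(|\iota_a|)(\sigma)\le D(|\iota_b|)(\tau)$. Here $\iota_a,\iota_b$ are the inclusions of $a,b$ into $a\cup b$,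 and for an embedding $f:s\to t$ of finite orders, $|f|:|s|\to|t|$ is the embedding induced via the increasing enumerations of $s$ and $t$. An embedding $f:\alpha\to\beta$ induces the embedding $\overline D(f)(\sigma,a)=(\sigma,[f]^{<\omega}(a))$ of $\overline D(\alpha)$ into $\overline D(\beta)$. A predilator $D$ is a *dilator* if $\overline D(\alpha)$ is well-founded for every well order $\alpha$. Given a linear order $L=(\mathbb N,\le_L)$, let $\pi^L_n$ be the permutation of $\{0,\dots,n-1\}$ with $\pi^L_n(i)\le\pi^L_n(j)\Leftrightarrow i\le_L j$. Let $D_L(\alpha)$ be the set of finite sequences $\sigma=\langle x_0,\dots,x_{n-1}\rangle$ with $x_0<\dots<x_{n-1}$ in $\alpha$, write $l(\sigma)=n$ and $\sigma^L_i=x_{\pi^L_n(i)}$, and order $D_L(\alpha)$ by declaring $\sigma<\tau$ if either there is $j<\min(l(\sigma),l(\tau))$ with $\sigma^L_j<\tau^L_j$ and $\sigma^L_i=\tau^L_i$ for all $i<j$, or $l(\sigma)<l(\tau)$ and $\sigma^L_i=\tau^L_i$ for all $i<l(\sigma)$. An embedding $f:\alpha\to\beta$ acts on $D_L$ entrywise.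 Let $\omega\cdot(1+\alpha)$ be the order with elements $\omega\cdot x+n$ for $x\in 1+\alpha$ and $n\in\mathbb N$, compared lexicographically with $x$ taking precedence. An embedding $f:\alpha\to\beta$ induces $\omega\cdot(1+f):\omega\cdot(1+\alpha)\to\omega\cdot(1+\beta)$, which fixes each $\omega\cdot 0+n$ and sends $\omega\cdot(1+x)+n$ to $\omega\cdot(1+f(x))+n$. The order $L$ is a *thread* of a predilator $D$ if there is a family of embeddings $\eta_\alpha:D_L(\alpha)\to\overline D(\omega\cdot(1+\alpha))$, for all linear orders $\alpha$, that is natural, i.e. $\eta_\beta\circ D_L(f)=\overline D(\omega\cdot(1+f))\circ\eta_\alpha$ for every embedding $f:\alpha\to\beta$. **Statement.** A predilator $D$ is a dilator if and only if $\overline D(\omega^2)$ is a well order and every thread $L=(\mathbb N,\le_L)$ of $D$ is ill-founded. -/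

import Mathlib

/-- A (coded) predilator: a monotone functor from the category of the finite orders
`n = {0, …, n - 1}` and order embeddings to the category of countable linear orders and order
embeddings, together with a natural transformation to the finite powerset functor that satisfies
the support condition. -/
structure Predilator where
  /-- the linear order `D(n)` -/
  obj : ℕ → Type
  [order : ∀ n, LinearOrder (obj n)]
  [countable : ∀ n, Countable (obj n)]
  /-- the embedding `D(f) : D(m) → D(n)` -/
  map : ∀ {m n : ℕ}, (Fin m ↪o Fin n) → (obj m ↪o obj n)
  map_id : ∀ (n : ℕ) (σ : obj n), map (RelEmbedding.refl (· ≤ ·)) σ = σ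
  map_comp : ∀ {k m n : ℕ} (f : Fin k ↪o Fin m) (g : Fin m ↪o Fin n) (σ : obj k),
    map (f.trans g) σ = map g (map f σ)
  map_mono : ∀ {m n : ℕ} (f g : Fin m ↪o Fin n), (∀ i, f i ≤ g i) → ∀ σ, map f σ ≤ map g σ
  /-- the finite support of an element of `D(n)` -/
  supp : ∀ {n : ℕ}, obj n → Finset (Fin n)
  supp_map : ∀ {m n : ℕ} (f : Fin m ↪o Fin n) (σ : obj m),
    supp (map f σ) = (supp σ).map f.toEmbedding
  supp_cond : ∀ {m n : ℕ} (f : Fin m ↪o Fin n) (τ : obj n),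
    (∀ i ∈ supp τ, i ∈ Set.range f) → τ ∈ Set.range (map f)

attribute [instance] Predilator.order Predilator.countable

/-- For finite suborders `s` and `t` with `m` and `n` elements, respectively, each embedding
`f : s → t` yields a unique embedding `|f| : m → n` with `en_t ∘ |f| = f ∘ en_s`, where `en`
denotes increasing enumerations. -/
def enumHom {α β : Type} [LinearOrder α] [LinearOrder β] {s : Finset α} {t : Finset β}
    {m n : ℕ} (hs : s.card = m) (ht : t.card = n) (f : s ↪o t) : Fin m ↪o Fin n :=
  ((s.orderIsoOfFin hs).toOrderEmbedding.trans f).trans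
    (t.orderIsoOfFin ht).symm.toOrderEmbedding

theorem enumHom_spec {α β : Type} [LinearOrder α] [LinearOrder β] {s : Finset α} {t : Finset β}
    {m n : ℕ} (hs : s.card = m) (ht : t.card = n) (f : s ↪o t) (i : Fin m) :
    t.orderIsoOfFin ht (enumHom hs ht f i) = f (s.orderIsoOfFin hs i) := by
  simp [enumHom]

/-- The inclusion map between finite suborders, as an order embedding. -/
def inclEmb {α : Type} [LinearOrder α] {s t : Finset α} (h : s ⊆ t) : s ↪o t :=
  Subtype.orderEmbedding (fun _ hx => h hx)

namespace Predilator

/-- The set `D̄(α)` of pairs `(σ, a)` where `a` is a finite subset of `α` and `σ ∈ D(|a|)` has full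
support. The number `|a|` is recorded as `arity`. -/
@[ext]
structure Ext (D : Predilator) (α : Type) where
  /-- the number `|a|` -/
  arity : ℕ
  /-- the component `σ ∈ D(|a|)` -/
  elem : D.obj arity
  /-- the component `a` -/
  args : Finset α
  card_args : args.card = arity
  supp_elem : D.supp elem = Finset.univ

namespace Ext

variable {D : Predilator} {α β : Type} [LinearOrder α] [LinearOrder β]

/-- `(σ, a) ≤ (τ, b)` if and only if `D(|ι_a|)(σ) ≤ D(|ι_b|)(τ)` for the inclusions `ι_a` and `ι_b`
of `a` and `b` into `a ∪ b`. -/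
instance : LE (D.Ext α) where
  le x y :=
    D.map (enumHom x.card_args rfl (inclEmb (Finset.subset_union_left (s₂ := y.args)))) x.elem ≤
      D.map (enumHom y.card_args rfl (inclEmb (Finset.subset_union_right (s₁ := x.args)))) y.elem

theorem le_iff_of_factor (x y : D.Ext α) {k : ℕ} (e : Fin k ↪o α) (f : Fin x.arity ↪o Fin k)
    (g : Fin y.arity ↪o Fin k) (hf : ∀ i, e (f i) = x.args.orderEmbOfFin x.card_args i)
    (hg : ∀ i, e (g i) = y.args.orderEmbOfFin y.card_args i) :
    x ≤ y ↔ D.map f x.elem ≤ D.map g y.elem := by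
  classical
  have key : ∀ j, ∃ i, e i = (x.args ∪ y.args).orderEmbOfFin rfl j := by
    intro j
    have hj := Finset.orderEmbOfFin_mem (x.args ∪ y.args) rfl j
    rcases Finset.mem_union.1 hj with h | h
    · rw [← Finset.mem_coe, ← Finset.range_orderEmbOfFin _ x.card_args] at h
      obtain ⟨i, hi⟩ := h
      exact ⟨f i, by rw [hf, hi]⟩
    · rw [← Finset.mem_coe, ← Finset.range_orderEmbOfFin _ y.card_args] at h
      obtain ⟨i, hi⟩ := h
      exact ⟨g i, by rw [hg, hi]⟩
  choose h hh using key
  let h' : Fin (x.args ∪ y.args).card ↪o Fin k := OrderEmbedding.ofMapLEIff h (by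
    intro i j
    rw [← e.le_iff_le, hh, hh, OrderEmbedding.le_iff_le])
  have h1 : f = (enumHom x.card_args rfl
      (inclEmb (Finset.subset_union_left (s₂ := y.args)))).trans h' := by
    ext i : 1
    apply e.injective
    rw [hf]
    refine Eq.trans ?_ (hh (enumHom x.card_args rfl (inclEmb
      (Finset.subset_union_left (s₂ := y.args))) i)).symm
    rw [← Finset.coe_orderIsoOfFin_apply, ← Finset.coe_orderIsoOfFin_apply, enumHom_spec]
    rfl
  have h2 : g = (enumHom y.card_args rfl
      (inclEmb (Finset.subset_union_right (s₁ := x.args)))).trans h' := by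
    ext i : 1
    apply e.injective
    rw [hg]
    refine Eq.trans ?_ (hh (enumHom y.card_args rfl (inclEmb
      (Finset.subset_union_right (s₁ := x.args))) i)).symm
    rw [← Finset.coe_orderIsoOfFin_apply, ← Finset.coe_orderIsoOfFin_apply, enumHom_spec]
    rfl
  rw [h1, h2, D.map_comp, D.map_comp, OrderEmbedding.le_iff_le]
  rfl

theorem exists_factor {x : D.Ext α} {s : Finset α} (h : x.args ⊆ s) :
    ∃ f : Fin x.arity ↪o Fin s.card,
      ∀ i, s.orderEmbOfFin rfl (f i) = x.args.orderEmbOfFin x.card_args i := by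
  refine ⟨enumHom x.card_args rfl (inclEmb h), fun i => ?_⟩
  rw [← Finset.coe_orderIsoOfFin_apply, ← Finset.coe_orderIsoOfFin_apply, enumHom_spec]
  rfl

theorem eq_of_map_eq (x y : D.Ext α) {k : ℕ} (e : Fin k ↪o α) (f : Fin x.arity ↪o Fin k)
    (g : Fin y.arity ↪o Fin k) (hf : ∀ i, e (f i) = x.args.orderEmbOfFin x.card_args i)
    (hg : ∀ i, e (g i) = y.args.orderEmbOfFin y.card_args i)
    (h : D.map f x.elem = D.map g y.elem) : x = y := by
  classical
  have hs := congrArg D.supp h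
  rw [D.supp_map, D.supp_map, x.supp_elem, y.supp_elem] at hs
  have hx : x.args = (Finset.univ.map f.toEmbedding).map e.toEmbedding := by
    conv_lhs => rw [← Finset.map_orderEmbOfFin_univ x.args x.card_args]
    rw [Finset.map_map]
    congr 1
    ext i
    exact (hf i).symm
  have hy : y.args = (Finset.univ.map g.toEmbedding).map e.toEmbedding := by
    conv_lhs => rw [← Finset.map_orderEmbOfFin_univ y.args y.card_args]
    rw [Finset.map_map]
    congr 1
    ext i
    exact (hg i).symm
  have hxy : x.args = y.args := by rw [hx, hy, hs]
  obtain ⟨m, σ, a, ha, hσ⟩ := x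
  obtain ⟨n, τ, b, hb, hτ⟩ := y
  dsimp only at *
  subst hxy
  subst ha
  subst hb
  have hfg : f = g := by
    ext i : 1
    apply e.injective
    rw [hf, hg]
  subst hfg
  have := (D.map f).injective h
  subst this
  rfl

noncomputable instance : LinearOrder (D.Ext α) where
  le_refl x := by
    obtain ⟨f, hf⟩ := exists_factor (Finset.Subset.refl x.args)
    exact (le_iff_of_factor x x _ f f hf hf).2 le_rfl
  le_trans x y z hxy hyz := by
    classical
    obtain ⟨f, hf⟩ := exists_factor (x := x) (s := x.args ∪ (y.args ∪ z.args)) (by grind)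
    obtain ⟨g, hg⟩ := exists_factor (x := y) (s := x.args ∪ (y.args ∪ z.args)) (by grind)
    obtain ⟨h, hh⟩ := exists_factor (x := z) (s := x.args ∪ (y.args ∪ z.args)) (by grind)
    rw [le_iff_of_factor x y _ f g hf hg] at hxy
    rw [le_iff_of_factor y z _ g h hg hh] at hyz
    exact (le_iff_of_factor x z _ f h hf hh).2 (hxy.trans hyz)
  le_antisymm x y hxy hyx := by
    classical
    obtain ⟨f, hf⟩ := exists_factor (x := x) (s := x.args ∪ y.args) (by grind)
    obtain ⟨g, hg⟩ := exists_factor (x := y) (s := x.args ∪ y.args) (by grind)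
    rw [le_iff_of_factor x y _ f g hf hg] at hxy
    rw [le_iff_of_factor y x _ g f hg hf] at hyx
    exact eq_of_map_eq x y _ f g hf hg (le_antisymm hxy hyx)
  le_total x y := by
    classical
    obtain ⟨f, hf⟩ := exists_factor (x := x) (s := x.args ∪ y.args) (by grind)
    obtain ⟨g, hg⟩ := exists_factor (x := y) (s := x.args ∪ y.args) (by grind)
    rw [le_iff_of_factor x y _ f g hf hg, le_iff_of_factor y x _ g f hg hf]
    exact le_total _ _
  toDecidableLE := Classical.decRel _

/-- The map `D̄(f) : D̄(α) → D̄(β)` with `D̄(f)(σ, a) = (σ, f[a])`. -/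
def mapFun (f : α ↪o β) (x : D.Ext α) : D.Ext β where
  arity := x.arity
  elem := x.elem
  args := x.args.map f.toEmbedding
  card_args := by rw [Finset.card_map, x.card_args]
  supp_elem := x.supp_elem

theorem orderEmbOfFin_mapFun (f : α ↪o β) (x : D.Ext α) (i : Fin x.arity) :
    f (x.args.orderEmbOfFin x.card_args i) =
      (mapFun f x).args.orderEmbOfFin (mapFun f x).card_args i := by
  have := Finset.orderEmbOfFin_unique' (mapFun f x).card_args
    (f := (x.args.orderEmbOfFin x.card_args).trans f) (fun j => by
      exact Finset.mem_map_of_mem _ (Finset.orderEmbOfFin_mem _ _ _))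
  exact congrArg (fun g => g i) this

/-- The order embedding `D̄(f) : D̄(α) → D̄(β)` for an order embedding `f : α → β`. -/
noncomputable def map (f : α ↪o β) : D.Ext α ↪o D.Ext β :=
  OrderEmbedding.ofMapLEIff (mapFun f) (by
    classical
    intro x y
    obtain ⟨g, hg⟩ := exists_factor (x := x) (s := x.args ∪ y.args) (by grind)
    obtain ⟨h, hh⟩ := exists_factor (x := y) (s := x.args ∪ y.args) (by grind)
    rw [le_iff_of_factor x y _ g h hg hh]
    exact le_iff_of_factor (mapFun f x) (mapFun f y)
      (((x.args ∪ y.args).orderEmbOfFin rfl).trans f) g h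
      (fun i => (congrArg f (hg i)).trans (orderEmbOfFin_mapFun f x i))
      (fun i => (congrArg f (hh i)).trans (orderEmbOfFin_mapFun f y i)))

end Ext

/-- A predilator `D` is a dilator if `D̄(α)` is well-founded for every (countable) well order `α`. -/
def IsDilator (D : Predilator) : Prop :=
  ∀ (α : Type) [LinearOrder α] [Countable α], WellFoundedLT α → WellFoundedLT (D.Ext α)

end Predilator

/-- For a linear order `L` on `ℕ` with strict part `lt`, the permutation `π^L_n` of
`{0, …, n - 1}` sends `i` to the number of `k < n` with `k <_L i`. -/
noncomputable def permL (lt : ℕ → ℕ → Prop) [IsStrictTotalOrder ℕ lt] (n : ℕ) (i : Fin n) :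
    Fin n :=
  haveI : DecidablePred fun k : Fin n => lt k i := Classical.decPred _
  ⟨(Finset.univ.filter fun k : Fin n => lt k i).card, by
    have h : (Finset.univ.filter fun k : Fin n => lt k i) ⊂ Finset.univ :=
      Finset.filter_ssubset.2 ⟨i, Finset.mem_univ _, irrefl_of lt (i : ℕ)⟩
    simpa using Finset.card_lt_card h⟩

/-- The property that determines `π^L_n`, in terms of the strict orders. -/
theorem permL_lt_iff (lt : ℕ → ℕ → Prop) [IsStrictTotalOrder ℕ lt] (n : ℕ) (i j : Fin n) :
    permL lt n i < permL lt n j ↔ lt i j := by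
  classical
  have key : ∀ i j : Fin n, lt i j → permL lt n i < permL lt n j := by
    intro i j hij
    simp only [permL, Fin.lt_def]
    apply Finset.card_lt_card
    rw [Finset.ssubset_iff_of_subset]
    · exact ⟨i, by simpa using hij, by simpa using irrefl_of lt (i : ℕ)⟩
    · intro k hk
      simp only [Finset.mem_filter, Finset.mem_univ, true_and] at hk ⊢
      exact _root_.trans hk hij
  refine ⟨fun h => ?_, key i j⟩
  rcases trichotomous_of lt (i : ℕ) (j : ℕ) with h' | h' | h'
  · exact h'
  · rw [Fin.ext h'] at h
    exact absurd h (lt_irrefl _)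
  · exact absurd (h.trans (key j i h')) (lt_irrefl _)

theorem permL_bijective (lt : ℕ → ℕ → Prop) [IsStrictTotalOrder ℕ lt] (n : ℕ) :
    Function.Bijective (permL lt n) := by
  rw [← Finite.injective_iff_bijective]
  intro i j hij
  rcases trichotomous_of lt (i : ℕ) (j : ℕ) with h | h | h
  · exact absurd hij ((permL_lt_iff lt n i j).2 h).ne
  · exact Fin.ext h
  · exact absurd hij ((permL_lt_iff lt n j i).2 h).ne'

/-- The set `D_L(α)` of finite sequences `⟨x₀, …, x_{n-1}⟩` with `x₀ < … < x_{n-1}` in `α`, for a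
linear order `L` on `ℕ` with strict part `lt`. -/
structure DL (lt : ℕ → ℕ → Prop) (α : Type) [LinearOrder α] where
  /-- the length of the sequence -/
  len : ℕ
  /-- the increasing sequence -/
  seq : Fin len ↪o α

namespace DL

variable {lt : ℕ → ℕ → Prop} [IsStrictTotalOrder ℕ lt] {α β : Type} [LinearOrder α] [LinearOrder β]

/-- The permuted entry `σ^L_i = σ(π^L_{l(σ)}(i))`. -/
noncomputable def entry (σ : DL lt α) (i : ℕ) (hi : i < σ.len) : α :=
  σ.seq (permL lt σ.len ⟨i, hi⟩)

/-- The permuted lexicographic order on `D_L(α)`. -/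
instance : LT (DL lt α) where
  lt σ τ :=
    (∃ (j : ℕ) (hσ : j < σ.len) (hτ : j < τ.len), σ.entry j hσ < τ.entry j hτ ∧
      ∀ (i : ℕ) (hi : i < j), σ.entry i (hi.trans hσ) = τ.entry i (hi.trans hτ)) ∨
    (∃ h : σ.len < τ.len, ∀ (i : ℕ) (hi : i < σ.len), σ.entry i hi = τ.entry i (hi.trans h))

/-- The list of the permuted entries. -/
noncomputable def word (σ : DL lt α) : List α :=
  List.ofFn fun i : Fin σ.len => σ.entry i i.2

theorem word_injective : Function.Injective (word (lt := lt) (α := α)) := by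
  rintro ⟨m, f⟩ ⟨n, g⟩ h
  have hmn : m = n := by simpa [word] using congrArg List.length h
  subst hmn
  have h' := List.ofFn_injective h
  congr 1
  ext i : 1
  obtain ⟨j, rfl⟩ := (permL_bijective lt m).2 i
  exact congrFun h' j

theorem lt_iff_word (σ τ : DL lt α) : σ < τ ↔ σ.word < τ.word := by
  rw [List.lt_iff_exists, or_comm]
  refine or_congr ?_ ?_
  · constructor
    · rintro ⟨j, hσ, hτ, h, h'⟩
      exact ⟨j, by simpa [word] using hσ, by simpa [word] using hτ,
        by simpa [word] using h', by simpa [word] using h⟩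
    · rintro ⟨j, hσ, hτ, h', h⟩
      refine ⟨j, by simpa [word] using hσ, by simpa [word] using hτ,
        by simpa [word] using h, fun i hi => by simpa [word] using h' i hi⟩
  · constructor
    · rintro ⟨h, h'⟩
      refine ⟨?_, by simpa [word] using h⟩
      apply List.ext_getElem
      · simp [word, h.le]
      · intro i h1 h2
        simpa [word] using h' i (by simpa [word] using h1)
    · rintro ⟨h', h⟩
      refine ⟨by simpa [word] using h, fun i hi => ?_⟩
      have h1 : i < σ.word.length := by simpa [word] using hi
      have := List.getElem_of_eq h' h1
      simpa [word] using this

noncomputable instance : LinearOrder (DL lt α) where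
  le σ τ := σ < τ ∨ σ = τ
  le_refl σ := Or.inr rfl
  le_trans σ τ ρ := by
    simp only [lt_iff_word, ← word_injective.eq_iff, ← le_iff_lt_or_eq]
    exact le_trans
  lt_iff_le_not_ge σ τ := by
    simp only [lt_iff_word, ← word_injective.eq_iff, ← le_iff_lt_or_eq]
    exact lt_iff_le_not_ge
  le_antisymm σ τ := by
    simp only [lt_iff_word, ← word_injective.eq_iff, ← le_iff_lt_or_eq]
    exact le_antisymm
  le_total σ τ := by
    simp only [lt_iff_word, ← word_injective.eq_iff, ← le_iff_lt_or_eq]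
    exact le_total _ _
  toDecidableLE := Classical.decRel _

/-- The map `D_L(f)` with `D_L(f)(⟨x₀, …, x_{n-1}⟩) = ⟨f(x₀), …, f(x_{n-1})⟩`. -/
def map (f : α ↪o β) (σ : DL lt α) : DL lt β where
  len := σ.len
  seq := σ.seq.trans f

end DL

/-- The order `ω · (1 + α)`. The element `ω · x + n` with `x ∈ 1 + α` and `n ∈ ℕ` is represented by
the pair `(x, n)`, and such pairs are compared lexicographically with `x` taking precedence. -/
abbrev OmegaMul (α : Type) : Type := WithBot α ×ₗ ℕ

/-- The embedding `ω · (1 + f)` of `ω · (1 + α)` into `ω · (1 + β)`, with `ω · 0 + n ↦ ω · 0 + n`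
and `ω · (1 + x) + n ↦ ω · (1 + f(x)) + n`. -/
def OmegaMul.map {α β : Type} [LinearOrder α] [LinearOrder β] (f : α ↪o β) :
    OmegaMul α ↪o OmegaMul β :=
  OrderEmbedding.ofMapLEIff (fun p => toLex (f.withBotMap (ofLex p).1, (ofLex p).2)) (by
    intro p q
    simp only [Prod.Lex.le_iff, ofLex_toLex, OrderEmbedding.lt_iff_lt, EmbeddingLike.apply_eq_iff_eq])

/-- A linear order `L` with underlying set `ℕ` and strict part `lt` is a thread of the predilator
`D` if there is a natural family of embeddings `D_L(α) → D̄(ω · (1 + α))`, where `α` ranges over the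
(countable) linear orders. -/
def Predilator.IsThread (D : Predilator) (lt : ℕ → ℕ → Prop) [IsStrictTotalOrder ℕ lt] : Prop :=
  ∃ η : ∀ (α : Type) [LinearOrder α] [Countable α], DL lt α ↪o D.Ext (OmegaMul α),
    ∀ (α β : Type) [LinearOrder α] [Countable α] [LinearOrder β] [Countable β] (f : α ↪o β)
      (σ : DL lt α), η β (DL.map f σ) = Predilator.Ext.map (OmegaMul.map f) (η α σ)

/-! Suppose that `D` is a dilator and that some thread `L` is well-founded. Then D_L(L × 2) embeds
into the well order D̄(ω·(1 + L × 2)). However, the words with permuted entries (0,0), …, (n-1,0),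
(n,1) descend in D_L(L × 2), as the entry (n,1) drops to (n,0) at the next stage
(`exists_strictAnti_DL`).

Conversely, let d be a descending sequence in D̄(γ) for a well order γ. Fix a finite set c of
arguments. Well-foundedness of D̄(ω²) forces that eventually d k lies below d k' once all arguments
of d k off c are pushed below those of d k' in the same gap of c (`exists_forall_layered_le`). Each
such d k has a leading argument off c, and this argument decides comparisons between images of the d
k under embeddings that agree on c (`IsLeading.act_lt_act`). Leading arguments cannot increase along
d, so they stabilise at some a in the well order γ. Adding a to c and iterating yields distinct
points p 0, p 1, … of γ.

The order of the indices i by p i is a suborder of γ, hence well-founded. It is a thread: send a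
word w of length n to a late term e n of d, with p i moved to ω·(1 + w_i). The first difference
between two words then occurs at a leading argument, while all earlier p i have equal images, so the
lexicographic order is respected (`isThread_of_dominates`). -/

namespace Predilator.Ext

/-! ### Acting on D̄ by maps that increase only on the support -/

variable {D : Predilator} {α β γ δ ε : Type} [LinearOrder α] [LinearOrder β] [LinearOrder γ]
  [LinearOrder δ] [LinearOrder ε]

/-- The element `(σ, f[a])` for `x = (σ, a)` and a function `f` that is strictly increasing
on `a`. -/
def act (f : α → β) (x : D.Ext α) (hf : StrictMonoOn f x.args) : D.Ext β where
  arity := x.arity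
  elem := x.elem
  args := x.args.image f
  card_args := by rw [Finset.card_image_of_injOn hf.injOn, x.card_args]
  supp_elem := x.supp_elem

theorem orderEmbOfFin_act (f : α → β) (x : D.Ext α) (hf : StrictMonoOn f x.args)
    (i : Fin x.arity) :
    f (x.args.orderEmbOfFin x.card_args i) =
      (x.act f hf).args.orderEmbOfFin (x.act f hf).card_args i := by
  refine congrFun (Finset.orderEmbOfFin_unique (x.act f hf).card_args
    (f := fun i => f (x.args.orderEmbOfFin x.card_args i)) (fun j => ?_) (fun i j hij => ?_)) i
  · exact Finset.mem_image_of_mem _ (Finset.orderEmbOfFin_mem _ _ _)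
  · exact hf (Finset.orderEmbOfFin_mem _ _ _) (Finset.orderEmbOfFin_mem _ _ _)
      ((OrderEmbedding.lt_iff_lt _).2 hij)

theorem act_le_act_iff {f : α → β} {x y : D.Ext α} (hx : StrictMonoOn f x.args)
    (hy : StrictMonoOn f y.args) (hf : StrictMonoOn f (x.args ∪ y.args : Finset α)) :
    x.act f hx ≤ y.act f hy ↔ x ≤ y := by
  obtain ⟨g, hg⟩ := exists_factor (x := x) (s := x.args ∪ y.args) (by grind)
  obtain ⟨h, hh⟩ := exists_factor (x := y) (s := x.args ∪ y.args) (by grind)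
  rw [le_iff_of_factor x y _ g h hg hh]
  refine le_iff_of_factor (x.act f hx) (y.act f hy)
    (OrderEmbedding.ofStrictMono (fun i => f ((x.args ∪ y.args).orderEmbOfFin rfl i)) ?_) g h
    (fun i => (congrArg f (hg i)).trans (orderEmbOfFin_act f x hx i))
    (fun i => (congrArg f (hh i)).trans (orderEmbOfFin_act f y hy i))
  exact fun i j hij => hf (Finset.orderEmbOfFin_mem _ _ _) (Finset.orderEmbOfFin_mem _ _ _)
      ((OrderEmbedding.lt_iff_lt _).2 hij)

theorem act_le_act {f g : α → β} {x : D.Ext α} (hf : StrictMonoOn f x.args)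
    (hg : StrictMonoOn g x.args) (h : ∀ z ∈ x.args, f z ≤ g z) : x.act f hf ≤ x.act g hg := by
  set s := (x.act f hf).args ∪ (x.act g hg).args
  obtain ⟨F, hF⟩ := exists_factor (x := x.act f hf) (s := s) Finset.subset_union_left
  obtain ⟨G, hG⟩ := exists_factor (x := x.act g hg) (s := s) Finset.subset_union_right
  rw [le_iff_of_factor _ _ _ F G hF hG]
  refine D.map_mono F G (fun i => ?_) x.elem
  refine (s.orderEmbOfFin rfl).le_iff_le.1 (((hF i).trans_le ?_).trans_eq (hG i).symm)
  exact (orderEmbOfFin_act f x hf i).symm.trans_le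
    ((h _ (Finset.orderEmbOfFin_mem _ _ _)).trans_eq (orderEmbOfFin_act g x hg i))

theorem act_congr {f g : α → β} {x : D.Ext α} (hf : StrictMonoOn f x.args)
    (hg : StrictMonoOn g x.args) (h : ∀ z ∈ x.args, f z = g z) : x.act f hf = x.act g hg :=
  le_antisymm (act_le_act _ _ fun z hz => (h z hz).le) (act_le_act _ _ fun z hz => (h z hz).ge)

theorem act_act {f : α → β} {g : β → δ} {x : D.Ext α} (hf : StrictMonoOn f x.args)
    (hg : StrictMonoOn g (x.act f hf).args) (hgf : StrictMonoOn (g ∘ f) x.args) :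
    (x.act f hf).act g hg = x.act (g ∘ f) hgf := by
  ext : 1
  · rfl
  · exact HEq.rfl
  · exact Finset.image_image

theorem map_eq_act (f : α ↪o β) (x : D.Ext α) :
    map f x = x.act f (f.strictMono.strictMonoOn _) := by
  ext : 1
  · rfl
  · exact HEq.rfl
  · exact Finset.map_eq_image _ _

end Predilator.Ext

/-! ### Interpolation between finitely many prescribed values -/

section LexInterpolate

variable {ι α Q S : Type} [LinearOrder α] [LinearOrder Q] [OrderBot Q] [LinearOrder S]
  [OrderBot S]

/-- A function that sends the points `p i` for `i ∈ I` to `(q i, ⊥)`. All other points are placed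
right above the closest of these points that lies below, according to the values of `s`. -/
def lexInterpolate (I : Finset ι) (p : ι → α) (q : ι → Q) (s : α → S) (z : α) : Q ×ₗ S :=
  toLex ((I.filter (p · ≤ z)).sup q, if z ∈ I.image p then ⊥ else s z)

variable {I : Finset ι} {p : ι → α} {q : ι → Q} {s : α → S}

theorem lexInterpolate_apply_of_mem (hinj : Set.InjOn p I)
    (hpq : ∀ i ∈ I, ∀ j ∈ I, p i < p j → q i < q j) {i : ι} (hi : i ∈ I) :
    lexInterpolate I p q s (p i) = toLex (q i, ⊥) := by
  unfold lexInterpolate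
  rw [if_pos (Finset.mem_image_of_mem p hi)]
  congr 2
  apply le_antisymm
  · refine Finset.sup_le fun j hj => ?_
    rw [Finset.mem_filter] at hj
    rcases hj.2.lt_or_eq with h | h
    · exact (hpq j hj.1 i hi h).le
    · rw [hinj hj.1 hi h]
  · exact Finset.le_sup (Finset.mem_filter.2 ⟨hi, le_rfl⟩)

theorem sup_filter_lt (hpq : ∀ i ∈ I, ∀ j ∈ I, p i < p j → q i < q j)
    (hq : ∀ i ∈ I, ⊥ < q i) {z : α} {j : ι} (hj : j ∈ I) (h : z < p j) :
    (I.filter (p · ≤ z)).sup q < q j := by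
  rw [Finset.sup_lt_iff (hq j hj)]
  intro i hi
  rw [Finset.mem_filter] at hi
  exact hpq i hi.1 j hj (hi.2.trans_lt h)

theorem strictMonoOn_lexInterpolate (hinj : Set.InjOn p I)
    (hpq : ∀ i ∈ I, ∀ j ∈ I, p i < p j → q i < q j) (hq : ∀ i ∈ I, ⊥ < q i) {A : Set α}
    (hs : StrictMonoOn s A) (hs' : ∀ z ∈ A, ⊥ < s z) :
    StrictMonoOn (lexInterpolate I p q s) A := by
  intro z hz w hw hzw
  by_cases hwI : w ∈ I.image p
  · obtain ⟨j, hj, rfl⟩ := Finset.mem_image.1 hwI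
    rw [lexInterpolate_apply_of_mem hinj hpq hj]
    exact Prod.Lex.lt_iff.2 (Or.inl (sup_filter_lt hpq hq hj hzw))
  · have h1 : (I.filter (p · ≤ z)).sup q ≤ (I.filter (p · ≤ w)).sup q :=
      Finset.sup_mono fun i hi => by
        rw [Finset.mem_filter] at hi ⊢
        exact ⟨hi.1, hi.2.trans hzw.le⟩
    rw [Prod.Lex.lt_iff]
    rcases h1.lt_or_eq with h1 | h1
    · exact Or.inl h1
    · refine Or.inr ⟨h1, ?_⟩
      simp only [lexInterpolate, ofLex_toLex, if_neg hwI]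
      split_ifs
      · exact hs' w hw
      · exact hs hz hw hzw

end LexInterpolate

namespace Predilator.Ext

variable {D : Predilator} {α β γ δ ε : Type} [LinearOrder α] [LinearOrder β] [LinearOrder γ]
  [LinearOrder δ] [LinearOrder ε]

/-- The comparison between `D̄(f)(x)` and `D̄(g)(y)` depends monotonically on the relative position
of the values of `f` and `g`. -/
theorem act_le_act_of_favourable {x : D.Ext α} {y : D.Ext β} {f₀ : α → δ} {g₀ : β → δ}
    {f : α → ε} {g : β → ε} (hf₀ : StrictMonoOn f₀ x.args) (hg₀ : StrictMonoOn g₀ y.args)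
    (hf : StrictMonoOn f x.args) (hg : StrictMonoOn g y.args)
    (hlt : ∀ z ∈ x.args, ∀ w ∈ y.args, f₀ z < g₀ w → f z < g w)
    (heq : ∀ z ∈ x.args, ∀ w ∈ y.args, f₀ z = g₀ w → f z ≤ g w) :
    (x.act f₀ hf₀ ≤ y.act g₀ hg₀ → x.act f hf ≤ y.act g hg) ∧
      (x.act f₀ hf₀ < y.act g₀ hg₀ → x.act f hf < y.act g hg) := by
  -- A common target for both configurations: ψ ∘ f₀ agrees with φ ∘ f on the support of `x`, while
  -- ψ ∘ g₀ lies below φ ∘ g on that of `y`. Monotonicity of `D` then transfers the comparison.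
  let φ : ε → WithBot ε ×ₗ WithBot δ := fun p => toLex ((p : WithBot ε), ⊥)
  let ψ : δ → WithBot ε ×ₗ WithBot δ :=
    lexInterpolate x.args f₀ (fun z => (f z : WithBot ε)) (fun p => (p : WithBot δ))
  have hpq : ∀ i ∈ x.args, ∀ j ∈ x.args, f₀ i < f₀ j → (f i : WithBot ε) < f j :=
    fun i hi j hj h => WithBot.coe_lt_coe.2 (hf hi hj ((hf₀.lt_iff_lt hi hj).1 h))
  have hφ : StrictMono φ := fun p q h => Prod.Lex.lt_iff.2 (Or.inl (WithBot.coe_lt_coe.2 h))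
  have hψ : StrictMono ψ := by
    rw [← strictMonoOn_univ]
    exact strictMonoOn_lexInterpolate hf₀.injOn hpq (fun i _ => WithBot.bot_lt_coe _)
      (fun p _ q _ h => WithBot.coe_lt_coe.2 h) (fun i _ => WithBot.bot_lt_coe _)
  have hψf : ∀ z ∈ x.args, ψ (f₀ z) = φ (f z) := fun z hz =>
    lexInterpolate_apply_of_mem hf₀.injOn hpq hz
  have hψg : ∀ w ∈ y.args, ψ (g₀ w) ≤ φ (g w) := by
    intro w hw
    by_cases hwx : g₀ w ∈ x.args.image f₀
    · obtain ⟨z, hz, hzw⟩ := Finset.mem_image.1 hwx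
      rw [← hzw, hψf z hz, hφ.le_iff_le]
      exact heq z hz w hw hzw
    · refine (Prod.Lex.lt_iff.2 (Or.inl ?_)).le
      refine (Finset.sup_lt_iff (WithBot.bot_lt_coe _)).2 fun z hz => ?_
      rw [Finset.mem_filter] at hz
      refine WithBot.coe_lt_coe.2 (hlt z hz.1 w hw (hz.2.lt_of_ne ?_))
      exact fun h => hwx (Finset.mem_image.2 ⟨z, hz.1, h⟩)
  have e1 : (x.act f₀ hf₀).act ψ (hψ.strictMonoOn _) = (x.act f hf).act φ (hφ.strictMonoOn _) := by
    rw [act_act _ _ ((hψ.strictMonoOn Set.univ).comp hf₀ (Set.mapsTo_univ _ _)),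
      act_act _ _ ((hφ.strictMonoOn Set.univ).comp hf (Set.mapsTo_univ _ _))]
    exact act_congr _ _ hψf
  have e2 : (y.act g₀ hg₀).act ψ (hψ.strictMonoOn _) ≤ (y.act g hg).act φ (hφ.strictMonoOn _) := by
    rw [act_act _ _ ((hψ.strictMonoOn Set.univ).comp hg₀ (Set.mapsTo_univ _ _)),
      act_act _ _ ((hφ.strictMonoOn Set.univ).comp hg (Set.mapsTo_univ _ _))]
    exact act_le_act _ _ hψg
  constructor
  · intro h
    rw [← act_le_act_iff (hφ.strictMonoOn _) (hφ.strictMonoOn _) (hφ.strictMonoOn _), ← e1]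
    exact ((act_le_act_iff _ _ (hψ.strictMonoOn _)).2 h).trans e2
  · intro h
    rw [← not_le] at h ⊢
    rw [← act_le_act_iff (hφ.strictMonoOn _) (hφ.strictMonoOn _) (hφ.strictMonoOn _), ← e1]
    intro h'
    exact h ((act_le_act_iff _ _ (hψ.strictMonoOn _)).1 (e2.trans h'))

end Predilator.Ext

/-! ### Separating arguments into layers over a fixed finite set -/

section Layered

variable {γ δ : Type} [LinearOrder γ] [LinearOrder δ]

/-- The embedding that fixes the points of `c` and moves each other point `z` into layer `ℓ z` of
a room that is placed right above the closest element of `c` below `z`. -/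
def layered (c : Finset γ) (ℓ : γ →o ℕ) : γ ↪o WithBot γ ×ₗ WithBot (ℕ ×ₗ γ) :=
  OrderEmbedding.ofStrictMono
    (lexInterpolate c id (fun z => (z : WithBot γ)) fun z => ((toLex (ℓ z, z) : ℕ ×ₗ γ) :
      WithBot (ℕ ×ₗ γ))) (by
    rw [← strictMonoOn_univ]
    refine strictMonoOn_lexInterpolate Function.injective_id.injOn
      (fun i _ j _ h => WithBot.coe_lt_coe.2 h) (fun i _ => WithBot.bot_lt_coe _) ?_
      (fun i _ => WithBot.bot_lt_coe _)
    intro z _ w _ h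
    rw [WithBot.coe_lt_coe, Prod.Lex.lt_iff]
    exact (ℓ.monotone h.le).lt_or_eq.imp id fun h' => ⟨h', h⟩)

/-- The largest element of `c` that does not lie above `z`. -/
def floorIn (c : Finset γ) (z : γ) : WithBot γ :=
  (c.filter (· ≤ z)).sup fun z => (z : WithBot γ)

variable {c : Finset γ} {ℓ m : γ →o ℕ} {z w : γ}

theorem layered_apply_of_mem (hz : z ∈ c) : layered c ℓ z = toLex ((z : WithBot γ), ⊥) := by
  have h : ∀ i ∈ c, ∀ j ∈ c, id i < id j → (i : WithBot γ) < j :=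
    fun i _ j _ h => WithBot.coe_lt_coe.2 h
  exact lexInterpolate_apply_of_mem (q := fun z : γ => (z : WithBot γ))
    (s := fun z => ((toLex (ℓ z, z) : ℕ ×ₗ γ) : WithBot (ℕ ×ₗ γ)))
    Function.injective_id.injOn h hz

theorem layered_apply_of_notMem (hz : z ∉ c) :
    layered c ℓ z = toLex (floorIn c z, ((toLex (ℓ z, z) : ℕ ×ₗ γ) : WithBot (ℕ ×ₗ γ))) := by
  have hz' : z ∉ c.image id := by simpa using hz
  simp only [layered, OrderEmbedding.coe_ofStrictMono, lexInterpolate, if_neg hz', floorIn, id]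

theorem exists_of_floorIn_lt (h : floorIn c z < floorIn c w) : ∃ u ∈ c, z < u ∧ u ≤ w := by
  unfold floorIn at h
  rw [Finset.lt_sup_iff] at h
  obtain ⟨u, hu, h⟩ := h
  rw [Finset.mem_filter] at hu
  refine ⟨u, hu.1, ?_, hu.2⟩
  by_contra! h'
  exact h.not_ge (Finset.le_sup (s := c.filter (· ≤ z)) (f := fun z => (z : WithBot γ))
    (Finset.mem_filter.2 ⟨hu.1, h'⟩))

theorem floorIn_of_mem (hz : z ∈ c) : floorIn c z = z :=
  le_antisymm (Finset.sup_le fun _ hu => WithBot.coe_le_coe.2 (Finset.mem_filter.1 hu).2)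
    (Finset.le_sup (s := c.filter (· ≤ z)) (f := fun z => (z : WithBot γ))
      (Finset.mem_filter.2 ⟨hz, le_rfl⟩))

theorem floorIn_le (z : γ) : floorIn c z ≤ z :=
  Finset.sup_le fun _ hu => WithBot.coe_le_coe.2 (Finset.mem_filter.1 hu).2

theorem layered_le_layered (h : z ∉ c → ℓ z ≤ m z) : layered c ℓ z ≤ layered c m z := by
  by_cases hz : z ∈ c
  · rw [layered_apply_of_mem hz, layered_apply_of_mem hz]
  · rw [layered_apply_of_notMem hz, layered_apply_of_notMem hz, Prod.Lex.le_iff]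
    refine Or.inr ⟨rfl, WithBot.coe_le_coe.2 (Prod.Lex.le_iff.2 ?_)⟩
    exact (h hz).lt_or_eq.imp id fun h => ⟨h, le_rfl⟩

/-- Points in different gaps of `c` are separated by an element of `c`, where `f` and `g` agree.
Within one gap the layers decide. The assumption `hne` excludes ties, which would be broken by the
order of `γ` and would say nothing about `f z` and `g w`. -/
theorem lt_of_layered_lt {A B : Set γ} {f g : γ → δ} (hf : StrictMonoOn f (A ∪ c))
    (hg : StrictMonoOn g (B ∪ c)) (hfg : Set.EqOn f g c)
    (h : ∀ z ∈ A, z ∉ c → ∀ w ∈ B, w ∉ c → floorIn c z = floorIn c w → ℓ z < m w → f z < g w)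
    (hne : ∀ z ∈ A, ∀ w ∈ B, ℓ z ≠ m w) (hz : z ∈ A) (hw : w ∈ B)
    (hzw : layered c ℓ z < layered c m w) : f z < g w := by
  have key : floorIn c z < floorIn c w → f z < g w := by
    intro h
    obtain ⟨u, hu, hzu, huw⟩ := exists_of_floorIn_lt h
    refine (hf (Or.inl hz) (Or.inr hu) hzu).trans_le ?_
    rw [hfg hu]
    exact (hg.le_iff_le (Or.inr hu) (Or.inl hw)).2 huw
  have e (z) (ℓ : γ →o ℕ) : (ofLex (layered c ℓ z)).1 = floorIn c z := by
    by_cases hz : z ∈ c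
    · rw [layered_apply_of_mem hz, floorIn_of_mem hz]; rfl
    · rw [layered_apply_of_notMem hz]; rfl
  rw [Prod.Lex.lt_iff, e, e] at hzw
  rcases hzw with h' | ⟨h1, h2⟩
  · exact key h'
  by_cases hwc : w ∈ c
  · rw [layered_apply_of_mem hwc] at h2
    exact absurd h2 not_lt_bot
  by_cases hzc : z ∈ c
  · rw [hfg hzc]
    refine hg (Or.inr hzc) (Or.inl hw) (lt_of_le_of_ne ?_ fun h => hwc (h ▸ hzc))
    rw [← WithBot.coe_le_coe, ← floorIn_of_mem hzc, h1]
    exact floorIn_le w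
  · refine h z hz hzc w hw hwc h1 ?_
    rw [layered_apply_of_notMem hzc, layered_apply_of_notMem hwc] at h2
    rcases Prod.Lex.lt_iff.1 (WithBot.coe_lt_coe.1 h2) with h3 | h3
    · exact h3
    · exact absurd h3.1 (hne z hz w hw)

theorem eq_of_layered_eq {τ : Type} {A B : Set γ} {f g : γ → τ} (hfg : Set.EqOn f g c)
    (hne : ∀ z ∈ A, ∀ w ∈ B, ℓ z ≠ m w) (hz : z ∈ A) (hw : w ∈ B)
    (hzw : layered c ℓ z = layered c m w) : f z = g w := by
  by_cases hzc : z ∈ c <;> by_cases hwc : w ∈ c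
  · rw [layered_apply_of_mem hzc, layered_apply_of_mem hwc] at hzw
    have h1 : (z : WithBot γ) = w := (Prod.ext_iff.1 (toLex.injective hzw)).1
    rw [hfg hzc, WithBot.coe_injective h1]
  · rw [layered_apply_of_mem hzc, layered_apply_of_notMem hwc] at hzw
    exact absurd (Prod.ext_iff.1 (toLex.injective hzw)).2 WithBot.bot_ne_coe
  · rw [layered_apply_of_notMem hzc, layered_apply_of_mem hwc] at hzw
    exact absurd (Prod.ext_iff.1 (toLex.injective hzw)).2 WithBot.coe_ne_bot
  · rw [layered_apply_of_notMem hzc, layered_apply_of_notMem hwc] at hzw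
    have h1 := toLex.injective (WithBot.coe_injective (Prod.ext_iff.1 (toLex.injective hzw)).2)
    exact absurd (Prod.ext_iff.1 h1).1 (hne z hz w hw)

end Layered

/-! ### Leading arguments -/

namespace Predilator.Ext

variable {D : Predilator} {γ δ : Type} [LinearOrder γ] [LinearOrder δ] {c : Finset γ}
  {x y : D.Ext γ} {ℓ m ℓ' m' : γ →o ℕ}

theorem act_le_act_of_layered {f g : γ → δ} (hf : StrictMonoOn f (x.args ∪ c))
    (hg : StrictMonoOn g (y.args ∪ c)) (hfg : Set.EqOn f g c)
    (h : ∀ z ∈ x.args, z ∉ c → ∀ w ∈ y.args, w ∉ c → floorIn c z = floorIn c w → ℓ z < m w →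
      f z < g w)
    (hne : ∀ z ∈ x.args, ∀ w ∈ y.args, ℓ z ≠ m w) :
    (map (layered c ℓ) x ≤ map (layered c m) y →
      x.act f (hf.mono Set.subset_union_left) ≤ y.act g (hg.mono Set.subset_union_left)) ∧
    (map (layered c ℓ) x < map (layered c m) y →
      x.act f (hf.mono Set.subset_union_left) < y.act g (hg.mono Set.subset_union_left)) := by
  rw [map_eq_act, map_eq_act]
  exact act_le_act_of_favourable _ _ _ _
    (fun z hz w hw h' => lt_of_layered_lt hf hg hfg h hne hz hw h')
    (fun z hz w hw h' => (eq_of_layered_eq (A := x.args) (B := y.args) hfg hne hz hw h').le)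

/-- Only the relative order of the layers of `x` and `y` matters, so layers can be renumbered to
make room for intermediate ones. -/
theorem layered_relabel (hne : ∀ z ∈ x.args, ∀ w ∈ y.args, ℓ z ≠ m w)
    (h : ∀ z ∈ x.args, ∀ w ∈ y.args, ℓ z < m w → ℓ' z < m' w) :
    (map (layered c ℓ) x ≤ map (layered c m) y → map (layered c ℓ') x ≤ map (layered c m') y) ∧
    (map (layered c ℓ) x < map (layered c m) y →
      map (layered c ℓ') x < map (layered c m') y) := by
  rw [map_eq_act (layered c ℓ'), map_eq_act (layered c m')]
  refine act_le_act_of_layered ((layered c ℓ').strictMono.strictMonoOn _)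
    ((layered c m').strictMono.strictMonoOn _) (fun z hz => ?_)
    (fun z hz hzc w hw hwc hc hl => ?_) hne
  · rw [layered_apply_of_mem hz, layered_apply_of_mem hz]
  · rw [layered_apply_of_notMem hzc, layered_apply_of_notMem hwc, Prod.Lex.lt_iff]
    exact Or.inr ⟨hc, WithBot.coe_lt_coe.2 (Prod.Lex.lt_iff.2 (Or.inl (h z hz w hw hl)))⟩

theorem layered_mono (h : ∀ z ∈ x.args, z ∉ c → ℓ z ≤ m z) :
    map (layered c ℓ) x ≤ map (layered c m) x := by
  rw [map_eq_act, map_eq_act]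
  exact act_le_act _ _ fun z hz => layered_le_layered (h z hz)

theorem layered_congr (h : ∀ z ∈ x.args, z ∉ c → ℓ z = m z) :
    map (layered c ℓ) x = map (layered c m) x :=
  le_antisymm (layered_mono fun z hz hc => (h z hz hc).le)
    (layered_mono fun z hz hc => (h z hz hc).ge)

/-- Monotonicity gives the weak inequality. Equality would force equal supports, but the image of
`z` lies in a layer that the second support does not use. -/
theorem layered_strictMono {z : γ} (hz : z ∈ x.args) (hzc : z ∉ c)
    (h : ∀ z ∈ x.args, ∀ w ∈ x.args, ℓ z < m w) :
    map (layered c ℓ) x < map (layered c m) x := by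
  refine lt_of_le_of_ne (layered_mono fun z hz _ => (h z hz z hz).le) fun he => ?_
  have h1 : layered c ℓ z ∈ (map (layered c ℓ) x).args := Finset.mem_map_of_mem _ hz
  rw [he] at h1
  obtain ⟨w, hw, hzw⟩ := Finset.mem_map.1 h1
  change layered c m w = layered c ℓ z at hzw
  by_cases hwc : w ∈ c
  · rw [layered_apply_of_notMem hzc, layered_apply_of_mem hwc] at hzw
    exact absurd (Prod.ext_iff.1 (toLex.injective hzw)).2 WithBot.bot_ne_coe
  · rw [layered_apply_of_notMem hzc, layered_apply_of_notMem hwc] at hzw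
    have h1 := toLex.injective (WithBot.coe_injective (Prod.ext_iff.1 (toLex.injective hzw)).2)
    exact (h z hz w hw).ne' (Prod.ext_iff.1 h1).1

/-- The function with value `i` below `a` and value `j` from `a` on. -/
def stepLE (a : γ) (i j : ℕ) (h : i ≤ j) : γ →o ℕ where
  toFun z := if a ≤ z then j else i
  monotone' z w hzw := by
    dsimp only
    split_ifs with h1 h2
    exacts [le_rfl, absurd (h1.trans hzw) h2, h, le_rfl]

/-- The function with value `i` up to `a` and value `j` above `a`. -/
def stepLT (a : γ) (i j : ℕ) (h : i ≤ j) : γ →o ℕ where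
  toFun z := if a < z then j else i
  monotone' z w hzw := by
    dsimp only
    split_ifs with h1 h2
    exacts [le_rfl, absurd (h1.trans_le hzw) h2, h, le_rfl]

theorem stepLE_apply (a : γ) (i j : ℕ) (h : i ≤ j) (z : γ) :
    stepLE a i j h z = if a ≤ z then j else i := rfl

theorem stepLT_apply (a : γ) (i j : ℕ) (h : i ≤ j) (z : γ) :
    stepLT a i j h z = if a < z then j else i := rfl

variable (c x) in
/-- The element `a` of the support of `x` dominates the comparison of two images of `x` under
embeddings that agree on `c`. -/
structure IsLeading (a : γ) : Prop where
  mem : a ∈ x.args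
  notMem : a ∉ c
  le : map (layered c (stepLT a 0 2 (by simp))) x ≤ map (layered c (OrderHom.const γ 1)) x
  lt : map (layered c (OrderHom.const γ 1)) x < map (layered c (stepLE a 0 2 (by simp))) x

/-- Raise the arguments off `c` from layer 0 to layer 2 one by one, starting at the top. With none
raised the result is at most the image with constant layer 1, and with all raised it is above. The
argument at which the comparison switches is leading. -/
theorem exists_isLeading (h : ∃ z ∈ x.args, z ∉ c) : ∃ a, IsLeading c x a := by
  set A := x.args.filter (· ∉ c)
  set S := A.filter fun a =>
    map (layered c (OrderHom.const γ 1)) x < map (layered c (stepLE a 0 2 (by simp))) x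
  have hA : A.Nonempty := by
    obtain ⟨z, hz, hzc⟩ := h
    exact ⟨z, Finset.mem_filter.2 ⟨hz, hzc⟩⟩
  have hS : S.Nonempty := by
    refine ⟨A.min' hA, Finset.mem_filter.2 ⟨A.min'_mem hA, ?_⟩⟩
    have h1 := Finset.mem_filter.1 (A.min'_mem hA)
    rw [layered_congr (ℓ := stepLE _ 0 2 _) (m := OrderHom.const γ 2)]
    · exact layered_strictMono h1.1 h1.2 fun z _ w _ => by simp
    · intro z hz hzc
      exact if_pos (A.min'_le z (Finset.mem_filter.2 ⟨hz, hzc⟩))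
  set a := S.max' hS
  obtain ⟨ha, ha'⟩ := Finset.mem_filter.1 (S.max'_mem hS)
  obtain ⟨ha1, ha2⟩ := Finset.mem_filter.1 ha
  refine ⟨a, ha1, ha2, ?_, ha'⟩
  by_contra! hlt
  rcases (A.filter (a < ·)).eq_empty_or_nonempty with he | hne
  · rw [layered_congr (ℓ := stepLT a 0 2 _) (m := OrderHom.const γ 0)] at hlt
    · exact hlt.not_ge (layered_mono fun z _ _ => by simp)
    · intro z hz hzc
      refine if_neg fun haz => ?_
      have : z ∈ A.filter (a < ·) := Finset.mem_filter.2 ⟨Finset.mem_filter.2 ⟨hz, hzc⟩, haz⟩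
      simp [he] at this
  -- Off `c`, being above `a` means being at least the successor `b` of `a` in `A`, so `b` would
  -- contradict the maximality of `a`.
  · set b := (A.filter (a < ·)).min' hne
    obtain ⟨hb, hab⟩ := Finset.mem_filter.1 ((A.filter (a < ·)).min'_mem hne)
    rw [layered_congr (ℓ := stepLT a 0 2 _) (m := stepLE b 0 2 (by simp))] at hlt
    · exact hab.not_ge (S.le_max' b (Finset.mem_filter.2 ⟨hb, hlt⟩))
    · intro z hz hzc
      refine if_congr ⟨fun h => ?_, fun h => hab.trans_le h⟩ rfl rfl
      exact Finset.min'_le _ _ (Finset.mem_filter.2 ⟨Finset.mem_filter.2 ⟨hz, hzc⟩, h⟩)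

theorem IsLeading.act_lt_act {a b : γ} (hx : IsLeading c x a) (hy : IsLeading c y b)
    (hxy : map (layered c (OrderHom.const γ 0)) x ≤ map (layered c (OrderHom.const γ 1)) y)
    {f g : γ → δ} (hf : StrictMonoOn f (x.args ∪ c)) (hg : StrictMonoOn g (y.args ∪ c))
    (hfg : Set.EqOn f g c) (hab : f a < g b) :
    x.act f (hf.mono Set.subset_union_left) < y.act g (hg.mono Set.subset_union_left) := by
  -- The worst arrangement compatible with `f a < g b`: the layers 1, 5 of `x` and 0, 4 of `y`
  -- satisfy only 1 < 4, that is, `z ≤ a` and `b ≤ w`. Layers 2 and 3 are free for the constant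
  -- images that link `x` to `y`.
  refine (act_le_act_of_layered (ℓ := stepLT a 1 5 (by simp)) (m := stepLE b 0 4 (by simp)) hf hg
    hfg ?_ ?_).2 ?_
  · intro z hz _ w hw _ _ h
    have hza : z ≤ a := by
      by_contra! hza
      simp only [stepLT_apply, stepLE_apply, if_pos hza] at h
      split_ifs at h <;> omega
    have hbw : b ≤ w := by
      by_contra! hbw
      simp only [stepLE_apply, if_neg hbw.not_ge] at h
      exact absurd h (Nat.not_lt_zero _)
    exact ((hf.le_iff_le (Or.inl hz) (Or.inl hx.mem)).2 hza).trans_lt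
      (hab.trans_le ((hg.le_iff_le (Or.inl hy.mem) (Or.inl hw)).2 hbw))
  · intro z _ w _
    simp only [stepLT_apply, stepLE_apply]
    split_ifs <;> omega
  · have h1 := (layered_relabel (ℓ' := stepLT a 1 5 (by simp)) (m' := OrderHom.const γ 2)
      (fun z _ w _ => by simp only [stepLT_apply, OrderHom.const_coe_coe,
        Function.const_apply]; split_ifs <;> omega)
      (fun z _ w _ => by simp only [stepLT_apply, OrderHom.const_coe_coe,
        Function.const_apply]; split_ifs <;> omega)).1 hx.le
    have h2 := (layered_relabel (ℓ' := OrderHom.const γ 2) (m' := OrderHom.const γ 3)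
      (fun z _ w _ => by simp) (fun z _ w _ => by simp)).1 hxy
    have h3 := (layered_relabel (ℓ' := OrderHom.const γ 3) (m' := stepLE b 0 4 (by simp))
      (fun z _ w _ => by simp only [stepLE_apply, OrderHom.const_coe_coe,
        Function.const_apply]; split_ifs <;> omega)
      (fun z _ w _ => by simp only [stepLE_apply, OrderHom.const_coe_coe,
        Function.const_apply]; split_ifs <;> omega)).2 hy.lt
    exact (h1.trans h2).trans_lt h3

end Predilator.Ext

section Rank

variable {α : Type} [LinearOrder α]

/-- The positive number `n + 1`, where `n` counts the elements of `A` below `z`. -/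
def rankIn (A : Finset α) (z : α) : ℕ := (A.filter (· < z)).card + 1

theorem bot_lt_rankIn (A : Finset α) (z : α) : ⊥ < rankIn A z := Nat.succ_pos _

theorem strictMonoOn_rankIn (A : Finset α) : StrictMonoOn (rankIn A) A := by
  intro z hz w _ hzw
  refine Nat.succ_lt_succ (Finset.card_lt_card ?_)
  rw [Finset.ssubset_iff_of_subset]
  · exact ⟨z, Finset.mem_filter.2 ⟨hz, hzw⟩, by simp⟩
  · intro u hu
    rw [Finset.mem_filter] at hu ⊢
    exact ⟨hu.1, hu.2.trans hzw⟩

end Rank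

/-! ### Extracting dominating arguments from a descending sequence -/

namespace Predilator.Ext

variable {D : Predilator} {γ : Type} [LinearOrder γ] {d : ℕ → D.Ext γ}

/-- A failure for every `K` yields terms that descend even when each new term has its arguments off
`c` placed in the higher layer. Such a descent survives if each term is collapsed separately, with
only `c` treated uniformly, and ω² has room for this. -/
theorem exists_forall_layered_le (hD : WellFoundedLT (D.Ext (ℕ ×ₗ ℕ))) (hd : StrictAnti d)
    (c : Finset γ) : ∃ K, ∀ k ≥ K, ∀ k' ≥ K, map (layered c (OrderHom.const γ 0)) (d k) ≤
      map (layered c (OrderHom.const γ 1)) (d k') := by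
  by_contra! h
  have h' : ∀ K, ∃ k', map (layered c (OrderHom.const γ 1)) (d k') <
      map (layered c (OrderHom.const γ 0)) (d K) := by
    intro K
    obtain ⟨k, hk, k', -, hkk'⟩ := h K
    exact ⟨k', hkk'.trans_le ((OrderEmbedding.le_iff_le _).2 (hd.antitone hk))⟩
  choose F hF using h'
  let e : ℕ → D.Ext γ := fun i => d (F^[i] 0)
  have he : ∀ i, map (layered c (OrderHom.const γ 1)) (e (i + 1)) <
      map (layered c (OrderHom.const γ 0)) (e i) := by
    intro i
    simp only [e, Function.iterate_succ_apply']
    exact hF _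
  -- Elements of `c` go to positive multiples of ω, and the other arguments are enumerated by finite
  -- ranks above the nearest multiple.
  let f : ℕ → γ → ℕ ×ₗ ℕ := fun i =>
    lexInterpolate c id (rankIn c) (rankIn ((e i).args ∪ c))
  have hc : ∀ i ∈ c, ∀ j ∈ c, id i < id j → rankIn c i < rankIn c j :=
    fun i hi j hj h => strictMonoOn_rankIn c hi hj h
  have hf : ∀ i, StrictMonoOn (f i) ((e i).args ∪ c) := fun i => by
    rw [← Finset.coe_union]
    exact strictMonoOn_lexInterpolate Function.injective_id.injOn hc
      (fun i _ => bot_lt_rankIn c i) (strictMonoOn_rankIn _) (fun z _ => bot_lt_rankIn _ z)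
  refine not_strictAnti_of_wellFoundedLT
    (fun i => (e i).act (f i) ((hf i).mono Set.subset_union_left))
    (strictAnti_nat_of_succ_lt fun i => ?_)
  refine (act_le_act_of_layered (hf _) (hf _) (fun z hz => ?_) ?_ ?_).2 (he i)
  · exact (lexInterpolate_apply_of_mem Function.injective_id.injOn hc hz).trans
      (lexInterpolate_apply_of_mem Function.injective_id.injOn hc hz).symm
  -- No condition arises within a gap, since layer 1 is never below layer 0.
  · intro z _ _ w _ _ _ h
    simp at h
  · simp

theorem act_id (x : D.Ext γ) : x.act id (strictMono_id.strictMonoOn _) = x := by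
  ext : 1
  · rfl
  · exact HEq.rfl
  · exact Finset.image_id

theorem exists_forall_isLeading [WellFoundedLT γ] (hd : StrictAnti d) {c : Finset γ} {K : ℕ}
    (hK : ∀ k ≥ K, ∀ k' ≥ K, map (layered c (OrderHom.const γ 0)) (d k) ≤
      map (layered c (OrderHom.const γ 1)) (d k')) :
    ∃ a, ∃ K' ≥ K, ∀ k ≥ K', IsLeading c (d k) a := by
  have h : ∀ k, ∃ a, IsLeading c (d (K + k)) a := by
    intro k
    apply exists_isLeading
    -- If the support lay inside `c`, the layers would have no effect on this term, and `hK` would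
    -- contradict the descent to the next one.
    by_contra! h
    have h1 := hK (K + k) (by omega) (K + k + 1) (by omega)
    rw [layered_congr (m := OrderHom.const γ 1) fun z hz hzc => absurd (h z hz) hzc,
      OrderEmbedding.le_iff_le] at h1
    exact h1.not_gt (hd (Nat.lt_succ_self _))
  choose a ha using h
  -- For `f = g = id`, an increase of the leading argument would make the sequence increase.
  have hanti : ∀ k k', k < k' → a k' ≤ a k := by
    intro k k' hkk'
    by_contra! hlt
    have := (ha k).act_lt_act (ha k') (hK _ (by omega) _ (by omega)) (f := id) (g := id)
      (strictMono_id.strictMonoOn _) (strictMono_id.strictMonoOn _) (fun _ _ => rfl) hlt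
    rw [act_id, act_id] at this
    exact this.not_gt (hd (by omega))
  obtain ⟨_, ⟨k₀, rfl⟩, hmin⟩ := wellFounded_lt.has_min (Set.range a) ⟨_, 0, rfl⟩
  refine ⟨a k₀, K + k₀, by omega, fun k hk => ?_⟩
  obtain ⟨i, rfl⟩ : ∃ i, k = K + (k₀ + i) := ⟨k - K - k₀, by omega⟩
  have h1 : a (k₀ + i) = a k₀ := by
    refine le_antisymm ?_ (not_lt.1 (hmin _ ⟨_, rfl⟩))
    rcases Nat.eq_zero_or_pos i with rfl | hi
    · rfl
    · exact hanti _ _ (by omega)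
  rw [← h1]
  exact ha _

/-- Embeddings that agree on `c` map `x` below `y` when they move the element `a` upwards. -/
def Dominates (c : Finset γ) (a : γ) (x y : D.Ext γ) : Prop :=
  ∀ (δ : Type) [LinearOrder δ] (f g : γ → δ) (hf : StrictMonoOn f (x.args ∪ c))
    (hg : StrictMonoOn g (y.args ∪ c)), Set.EqOn f g c → f a < g a →
    x.act f (hf.mono Set.subset_union_left) < y.act g (hg.mono Set.subset_union_left)

theorem exists_dominates [WellFoundedLT γ] (hD : WellFoundedLT (D.Ext (ℕ ×ₗ ℕ)))
    (hd : StrictAnti d) (c : Finset γ) :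
    ∃ a ∉ c, ∃ K, ∀ k ≥ K, ∀ k' ≥ K, Dominates c a (d k) (d k') := by
  obtain ⟨K, hK⟩ := exists_forall_layered_le hD hd c
  obtain ⟨a, K', hKK', ha⟩ := exists_forall_isLeading hd hK
  exact ⟨a, (ha K' le_rfl).notMem, K', fun k hk k' hk' δ _ f g hf hg hfg h =>
    (ha k hk).act_lt_act (ha k' hk') (hK k (hKK'.trans hk) k' (hKK'.trans hk')) hf hg hfg h⟩

theorem exists_dominating_seq [WellFoundedLT γ] (hD : WellFoundedLT (D.Ext (ℕ ×ₗ ℕ)))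
    (hd : StrictAnti d) : ∃ (p : ℕ → γ) (e : ℕ → D.Ext γ), Function.Injective p ∧
      ∀ j m n, j ≤ m → j ≤ n → Dominates ((Finset.range j).image p) (p j) (e m) (e n) := by
  choose a ha K hK using fun c : Finset γ => exists_dominates hD hd c
  let C : ℕ → Finset γ := fun n => Nat.rec ∅ (fun _ c => insert (a c) c) n
  have hC : ∀ n, C n = (Finset.range n).image fun i => a (C i) := by
    intro n
    induction n with
    | zero => rfl
    | succ n ih =>
      rw [Finset.range_add_one, Finset.image_insert, ← ih]
  -- The bound for `C n` is included, so that `e n` can be compared at position `n` itself. This is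
  -- needed when a word of length `n` is a proper prefix of another one.
  refine ⟨fun i => a (C i), fun n => d ((Finset.range (n + 1)).sup fun i => K (C i)), ?_, ?_⟩
  · have hne : ∀ i j, i < j → a (C i) ≠ a (C j) := by
      intro i j hij h
      refine ha (C j) ?_
      rw [← h, hC j]
      exact Finset.mem_image.2 ⟨i, Finset.mem_range.2 hij, rfl⟩
    intro i j hij
    rcases lt_trichotomy i j with h | h | h
    exacts [absurd hij (hne i j h), h, absurd hij.symm (hne j i h)]
  · intro j m n hm hn
    rw [← hC]
    exact hK _ _ (Finset.le_sup (f := fun i => K (C i)) (Finset.mem_range.2 (by omega))) _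
      (Finset.le_sup (f := fun i => K (C i)) (Finset.mem_range.2 (by omega)))

end Predilator.Ext

/-! ### Words with permuted entries -/

namespace DL

variable {lt : ℕ → ℕ → Prop} [IsStrictTotalOrder ℕ lt] {α β : Type} [LinearOrder α] [LinearOrder β]

theorem entry_lt_entry (w : DL lt α) {i j : ℕ} (hi : i < w.len) (hj : j < w.len) (h : lt i j) :
    w.entry i hi < w.entry j hj :=
  (OrderEmbedding.lt_iff_lt _).2 ((permL_lt_iff lt w.len ⟨i, hi⟩ ⟨j, hj⟩).2 h)

theorem exists_entry_eq (n : ℕ) (y : Fin n → α) (hy : ∀ i j : Fin n, lt i j → y i < y j) :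
    ∃ w : DL lt α, ∃ h : w.len = n, ∀ i (hi : i < w.len), w.entry i hi = y ⟨i, h ▸ hi⟩ := by
  let e := Equiv.ofBijective _ (permL_bijective lt n)
  refine ⟨⟨n, OrderEmbedding.ofStrictMono (fun i => y (e.symm i)) fun i j hij => hy _ _ ?_⟩, rfl,
    fun i hi => congrArg y (e.symm_apply_apply ⟨i, hi⟩)⟩
  rw [← permL_lt_iff lt n]
  change e (e.symm i) < e (e.symm j)
  rwa [e.apply_symm_apply, e.apply_symm_apply]

/-- The permuted entries, continued with value `⊥`. -/
noncomputable def entryD (w : DL lt α) (i : ℕ) : WithBot α :=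
  if h : i < w.len then (w.entry i h : WithBot α) else ⊥

theorem entryD_of_lt (w : DL lt α) {i : ℕ} (h : i < w.len) : w.entryD i = w.entry i h :=
  dif_pos h

theorem entryD_map (f : α ↪o β) (w : DL lt α) (i : ℕ) :
    (DL.map f w).entryD i = f.withBotMap (w.entryD i) := by
  by_cases h : i < w.len
  · rw [entryD_of_lt w h, entryD_of_lt (DL.map f w) h]
    rfl
  · rw [entryD, entryD, dif_neg h, dif_neg (show ¬ i < (DL.map f w).len from h)]
    rfl

end DL

/-! ### A thread from dominating arguments -/

namespace Predilator

variable {D : Predilator} {γ α β : Type} [LinearOrder γ] [LinearOrder α] [LinearOrder β]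
  {lt : ℕ → ℕ → Prop} [IsStrictTotalOrder ℕ lt] {p : ℕ → γ} {e : ℕ → D.Ext γ}

theorem entryD_lt_entryD (hlt : ∀ i j, lt i j ↔ p i < p j) (w : DL lt α) :
    ∀ i ∈ Finset.range w.len, ∀ j ∈ Finset.range w.len, p i < p j → w.entryD i < w.entryD j := by
  intro i hi j hj h
  rw [Finset.mem_range] at hi hj
  rw [w.entryD_of_lt hi, w.entryD_of_lt hj, WithBot.coe_lt_coe]
  exact w.entry_lt_entry hi hj ((hlt i j).2 h)

theorem bot_lt_entryD (w : DL lt α) : ∀ i ∈ Finset.range w.len, ⊥ < w.entryD i := by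
  intro i hi
  rw [w.entryD_of_lt (Finset.mem_range.1 hi)]
  exact WithBot.bot_lt_coe _

variable (p e) in
/-- The function that sends `p i` to `ω · (1 + x)` for the `i`-th entry `x` of the word `w`, and all
other arguments right above such values. -/
noncomputable def threadFun (w : DL lt α) : γ → OmegaMul α :=
  lexInterpolate (Finset.range w.len) p w.entryD
    (rankIn ((e w.len).args ∪ (Finset.range w.len).image p))

theorem strictMonoOn_threadFun (hp : Function.Injective p) (hlt : ∀ i j, lt i j ↔ p i < p j)
    (w : DL lt α) : StrictMonoOn (threadFun p e w)
      ((e w.len).args ∪ (Finset.range w.len).image p : Finset γ) :=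
  strictMonoOn_lexInterpolate hp.injOn (entryD_lt_entryD hlt w) (bot_lt_entryD w)
    (strictMonoOn_rankIn _) fun z _ => bot_lt_rankIn _ z

theorem threadFun_apply (hp : Function.Injective p) (hlt : ∀ i j, lt i j ↔ p i < p j)
    (w : DL lt α) {i : ℕ} (hi : i < w.len) :
    threadFun p e w (p i) = toLex ((w.entry i hi : WithBot α), 0) := by
  rw [← w.entryD_of_lt hi]
  exact lexInterpolate_apply_of_mem hp.injOn (entryD_lt_entryD hlt w) (Finset.mem_range.2 hi)

/-- The first component is a finite maximum of entries, which commutes with `f`, and the second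
depends on `w` only through its length. -/
theorem threadFun_map (f : α ↪o β) (w : DL lt α) (z : γ) :
    threadFun p e (DL.map f w) z = OmegaMul.map f (threadFun p e w z) := by
  change toLex _ = toLex (f.withBotMap _, _)
  congr 2
  change ((Finset.range w.len).filter _).sup (DL.map f w).entryD = f.withBotMap
    (((Finset.range w.len).filter _).sup w.entryD)
  rw [Finset.apply_sup_eq_sup_comp_of_linearOrder _ f.withBotMap.monotone rfl]
  congr 1
  exact funext fun i => w.entryD_map f i

/-- In the shorter word, `p w.len` is not a prescribed point. It is placed in the copy of ω at the
largest entry `i` with `p i` below it, or at ⊥. That copy lies below the one for the new entry of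
`v`. -/
theorem threadFun_lt (hlt : ∀ i j, lt i j ↔ p i < p j) (hp : Function.Injective p)
    {w v : DL lt α} (h : w.len < v.len)
    (hwv : ∀ (i : ℕ) (hi : i < w.len), w.entry i hi = v.entry i (hi.trans h)) :
    threadFun p e w (p w.len) < threadFun p e v (p w.len) := by
  rw [threadFun_apply hp hlt v h, Prod.Lex.lt_iff]
  refine Or.inl ?_
  change ((Finset.range w.len).filter (p · ≤ p w.len)).sup w.entryD < _
  refine (Finset.sup_lt_iff (WithBot.bot_lt_coe _)).2 fun i hi => ?_
  rw [Finset.mem_filter, Finset.mem_range] at hi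
  rw [w.entryD_of_lt hi.1, hwv i hi.1]
  refine WithBot.coe_lt_coe.2 (v.entry_lt_entry _ _ ?_)
  exact (hlt _ _).2 (hi.2.lt_of_ne (hp.ne hi.1.ne))

theorem isThread_of_dominates (hp : Function.Injective p) (hlt : ∀ i j, lt i j ↔ p i < p j)
    (he : ∀ j m n, j ≤ m → j ≤ n →
      Ext.Dominates ((Finset.range j).image p) (p j) (e m) (e n)) : D.IsThread lt := by
  have hargs (α : Type) [LinearOrder α] (w : DL lt α) :
      StrictMonoOn (threadFun p e w) (e w.len).args :=
    (strictMonoOn_threadFun hp hlt w).mono (Finset.coe_subset.2 Finset.subset_union_left)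
  have hmono (α : Type) [LinearOrder α] :
      StrictMono fun w : DL lt α => (e w.len).act (threadFun p e w) (hargs α w) := by
    intro w v hwv
    -- Domination at stage `j` covers both clauses of the order on words: for a proper prefix, `j`
    -- is the length of the shorter word.
    have key (j : ℕ) (hw : j ≤ w.len) (hv : j ≤ v.len)
        (hj : ∀ (i : ℕ) (hi : i < j), w.entry i (hi.trans_le hw) = v.entry i (hi.trans_le hv))
        (h : threadFun p e w (p j) < threadFun p e v (p j)) :
        (e w.len).act (threadFun p e w) (hargs α w) <
          (e v.len).act (threadFun p e v) (hargs α v) := by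
      have hsub (u : DL lt α) (hu : j ≤ u.len) : StrictMonoOn (threadFun p e u)
          ((e u.len).args ∪ (Finset.range j).image p) := by
        refine (strictMonoOn_threadFun hp hlt u).mono ?_
        rw [← Finset.coe_union, Finset.coe_subset]
        exact Finset.union_subset_union_right
          (Finset.image_subset_image (Finset.range_subset_range.2 hu))
      refine he j w.len v.len hw hv _ _ _ (hsub w hw) (hsub v hv) (fun z hz => ?_) h
      obtain ⟨i, hi, rfl⟩ := Finset.mem_image.1 hz
      rw [Finset.mem_range] at hi
      rw [threadFun_apply hp hlt w (hi.trans_le hw), threadFun_apply hp hlt v (hi.trans_le hv),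
        hj i hi]
    rcases hwv with ⟨j, hw, hv, h, hj⟩ | ⟨h, hwv⟩
    · refine key j hw.le hv.le hj ?_
      rw [threadFun_apply hp hlt w hw, threadFun_apply hp hlt v hv, Prod.Lex.lt_iff]
      exact Or.inl (WithBot.coe_lt_coe.2 h)
    · exact key w.len le_rfl h.le hwv (threadFun_lt hlt hp h hwv)
  refine ⟨fun α _ _ => OrderEmbedding.ofStrictMono _ (hmono α), fun α β _ _ _ _ f w => ?_⟩
  have hcomp := ((OmegaMul.map f).strictMono.strictMonoOn Set.univ).comp (hargs α w)
    (Set.mapsTo_univ _ _)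
  rw [Ext.map_eq_act]
  refine Eq.trans ?_ (Ext.act_act (hargs α w) _ hcomp).symm
  exact Ext.act_congr (hargs β (DL.map f w)) hcomp fun z _ => threadFun_map f w z

theorem isDilator_of_forall_thread (hD : WellFoundedLT (D.Ext (ℕ ×ₗ ℕ)))
    (h : ∀ (lt : ℕ → ℕ → Prop) [IsStrictTotalOrder ℕ lt], D.IsThread lt → ¬ WellFounded lt) :
    D.IsDilator := by
  intro γ _ _ hγ
  by_contra hwf
  obtain ⟨F⟩ : Nonempty (((· > ·) : ℕ → ℕ → Prop) ↪r ((· < ·) : D.Ext γ → D.Ext γ → Prop)) := by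
    rw [← not_isEmpty_iff, ← RelEmbedding.wellFounded_iff_isEmpty]
    exact fun h => hwf ⟨h⟩
  obtain ⟨p, e, hp, he⟩ :=
    Ext.exists_dominating_seq hD (d := F) fun m n hmn => F.map_rel_iff.2 hmn
  let G : (fun i j => p i < p j) ↪r ((· < ·) : γ → γ → Prop) := ⟨⟨p, hp⟩, Iff.rfl⟩
  have : IsStrictTotalOrder ℕ fun i j => p i < p j := G.isStrictTotalOrder
  exact h _ (isThread_of_dominates hp (fun _ _ => Iff.rfl) he) (G.wellFounded hγ.wf)

/-! ### Threads of dilators are ill-founded -/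

/-- The natural numbers, to be ordered by a given relation. -/
def Carrier (_ : ℕ → ℕ → Prop) : Type := ℕ

noncomputable instance : LinearOrder (Carrier lt) :=
  haveI : DecidableRel lt := Classical.decRel _
  linearOrderOfSTO (α := ℕ) lt

instance (lt : ℕ → ℕ → Prop) : Countable (Carrier lt) := inferInstanceAs (Countable ℕ)

theorem exists_strictAnti_DL (lt : ℕ → ℕ → Prop) [IsStrictTotalOrder ℕ lt] :
    ∃ w : ℕ → DL lt (Carrier lt ×ₗ Bool), StrictAnti w := by
  let a : ℕ → Bool → Carrier lt ×ₗ Bool := fun i b => toLex ((i : ℕ), b)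
  -- Doubling the points lets the last entry be the upper copy of `n`, which the next word replaces
  -- by the lower copy before it adds a further entry.
  have h (n : ℕ) := DL.exists_entry_eq (lt := lt) (n + 1)
    (fun i : Fin (n + 1) => a i (decide ((i : ℕ) = n)))
    (fun i j hij => Prod.Lex.lt_iff.2 (Or.inl hij))
  choose w hlen hw using h
  refine ⟨w, strictAnti_nat_of_succ_lt fun n => ?_⟩
  refine Or.inl ⟨n, by rw [hlen]; omega, by rw [hlen]; omega, ?_, fun i hi => ?_⟩
  · rw [hw, hw, Prod.Lex.lt_iff]
    exact Or.inr ⟨rfl, by simp [a]⟩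
  · rw [hw, hw]
    simp only [show i ≠ n by omega, show i ≠ n + 1 by omega, decide_false]

theorem IsDilator.not_wellFounded_of_isThread (hD : D.IsDilator) (hL : D.IsThread lt) :
    ¬ WellFounded lt := by
  intro hwf
  have : WellFoundedLT (Carrier lt) := ⟨hwf⟩
  have : Countable (Carrier lt ×ₗ Bool) :=
    inferInstanceAs (Countable (Carrier lt × Bool))
  have : Countable (OmegaMul (Carrier lt ×ₗ Bool)) :=
    inferInstanceAs (Countable (WithBot (Carrier lt ×ₗ Bool) × ℕ))
  obtain ⟨η, -⟩ := hL
  obtain ⟨w, hw⟩ := exists_strictAnti_DL lt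
  have := hD (OmegaMul (Carrier lt ×ₗ Bool)) inferInstance
  exact not_strictAnti_of_wellFoundedLT _ ((η _).strictMono.comp_strictAnti hw)

end Predilator

theorem mainTheorem11 (D : Predilator) :
    D.IsDilator ↔
      IsWellOrder (D.Ext (ℕ ×ₗ ℕ)) (· < ·) ∧
        ∀ (lt : ℕ → ℕ → Prop) [IsStrictTotalOrder ℕ lt], D.IsThread lt → ¬ WellFounded lt := by
  constructor
  · intro hD
    have : Countable (ℕ ×ₗ ℕ) := inferInstanceAs (Countable (ℕ × ℕ))
    have := hD (ℕ ×ₗ ℕ) inferInstance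
    exact ⟨inferInstance, fun lt _ => hD.not_wellFounded_of_isThread⟩
  · rintro ⟨hD, h⟩
    exact Predilator.isDilator_of_forall_thread ⟨hD.wf⟩ h
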